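/- Let $H$ be a separable infinite-dimensional complex Hilbert space, let $B(H)$ be the bounded linear operators on $H$, and let $K(H)$ be the compact ones. For a positive $a\in K(H)$ let $\lambda_1(a)\ge\lambda_2(a)\ge\cdots$ be its non-zero eigenvalues in decreasing order, counted with multiplicity, followed by zeros if $a$ has finite rank. Let $\alpha:\{0,1,2,\dots\}\to[0,\infty)$ be monotone increasing with $\alpha(0)=0$, and let $$\varphi_\alpha(a)=\sum_{i=1}^\infty\bigl(\lambda_i(a)-\lambda_{i+1}(a)\bigr)\,\alpha(i)\in[0,\infty]$$ be the non-linear trace of Choquet type associated with $\alpha$. Let $p\ge 1$ be a real number, and for $a\in K(H)$ put $|||a|||_{\alpha,p}=\varphi_\alpha(|a|^p)^{1/p}\in[0,\infty]$, where $|a|=(a^*a)^{1/2}$. **Theorem.** Suppose that $\alpha(1)>0$ and that $\alpha$ is concave, that is, $\frac{\alpha(i+1)+\alpha(i-1)}{2}\le\alpha(i)$ for all $i\ge1$. Then the weighted Schatten–von Neumann $p$-class $$\mathcal C^\alpha_p(H)=\{a\in K(H): |||a|||_{\alpha,p}<\infty\}$$ is a linear subspace of $B(H)$ and is a Banach space with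 respect to the norm $|||\cdot|||_{\alpha,p}$. Moreover, $\mathcal C^\alpha_p(H)$ is a $*$-ideal of $B(H)$, that is, a two-sided ideal closed under $a\mapsto a^*$. -/

import Mathlib

open scoped ENNReal NNReal

noncomputable section

namespace Choquet

variable {H : Type*} [NormedAddCommGroup H] [InnerProductSpace ℂ H]

/-- The span of all eigenvectors of `a` belonging to real eigenvalues `μ > t`. Since eigenspaces are
independent, its dimension is the number of eigenvalues `> t`, counted with multiplicity. -/
def upperEigenspace (a : H →L[ℂ] H) (t : ℝ) : Submodule ℂ H :=
  ⨆ (μ : ℝ) (_ : t < μ), Module.End.eigenspace (a : H →ₗ[ℂ] H) (μ : ℂ)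

/-- The eigenvalue sequence of a positive compact operator `a`: its positive eigenvalues in
decreasing order, counted with multiplicity, followed by zeros if `a` has finite rank. The index
starts at `0`, so `eigenvalueSeq a n` is the `(n + 1)`-st largest eigenvalue: the least level such
that at most `n` eigenvalues, counted with multiplicity, lie above it. -/
def eigenvalueSeq (a : H →L[ℂ] H) (n : ℕ) : ℝ :=
  sInf {t : ℝ | 0 < t ∧ Module.rank ℂ (upperEigenspace a t) ≤ n}

/-- The non-linear trace of Choquet type associated with `α`, of a positive compact operator `a`:
`∑ i ≥ 1, (λ_i(a) - λ_{i+1}(a)) α(i)`, with values in `[0, ∞]`. -/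
def choquetTrace (α : ℕ → ℝ≥0) (a : H →L[ℂ] H) : ℝ≥0∞ :=
  ∑' i : ℕ, ENNReal.ofReal (eigenvalueSeq a i - eigenvalueSeq a (i + 1)) * (α (i + 1) : ℝ≥0∞)

variable [CompleteSpace H]

/-- `φ_α(|a|^p)^{1/p}`, with values in `[0, ∞]`; here `|a| = (a* a)^{1/2}` and `|a|^p` is given by
the continuous functional calculus. -/
def schattenNorm (α : ℕ → ℝ≥0) (p : ℝ) (a : H →L[ℂ] H) : ℝ≥0∞ :=
  choquetTrace α (CFC.abs a ^ p) ^ (1 / p)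

variable (H) in
/-- The weighted Schatten-von Neumann `p`-class: the compact operators `a` on `H` with
`φ_α(|a|^p)^{1/p} < ∞`. -/
def schattenClass (α : ℕ → ℝ≥0) (p : ℝ) : Set (H →L[ℂ] H) :=
  {a | IsCompactOperator a ∧ schattenNorm α p a < ∞}

/-- The complex vector space `E` is a Banach space with respect to `N`: the function `N` is a norm
on `E`, and `E` is complete in this norm. -/
def IsBanachWith {E : Type*} [AddCommGroup E] [Module ℂ E] (N : E → ℝ) : Prop :=
  letI : Norm E := ⟨N⟩
  ∃ core : NormedSpace.Core ℂ E,
    letI : NormedAddCommGroup E := NormedAddCommGroup.ofCore core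
    CompleteSpace E

end Choquet

end

/-! Everything is read off the approximation numbers `s_j(a)`, the distances of `a` to the operators
of rank at most `j`. For compact `a` the eigenvalues of `|a|^p` are `s_j(a)^p`
(`eigenvalueSeq_abs_rpow`), and summation by parts turns `φ_α(|a|^p)` into `∑ (α(j+1) - α(j))
s_j(a)^p`. So `schattenNorm` is a weighted `ℓ^p` norm of `s(a)` (`schattenNorm_eq_weightedNorm`),
and concavity of `α` says that the weights decrease.

The triangle inequality is the hard point, since `s_j(a + b) ≤ s_j(a) + s_j(b)` fails in general. Ky
Fan's inequality gives it for partial sums over `j < k` (`sum_approxNumber_add_le`). Abel summation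
carries this domination through any decreasing weight, and Hölder's inequality then yields
Minkowski's (`weighted_Lp_le_add`).

The ideal properties follow from `s_j(ab), s_j(ba) ≤ ‖b‖ s_j(a)` and `s_j(a*) = s_j(a)`. For
completeness, `α(1)^{1/p} ‖a‖` is at most the new norm, so a Cauchy sequence has a compact
operator-norm limit. Each `s_j` is continuous, hence the new norm is lower semicontinuous and
convergence holds in it too. -/

noncomputable section

namespace Choquet

open scoped InnerProductSpace

/-! ### Spectral subspaces of compact symmetric operators. -/

section Spectral

variable {H : Type*} [NormedAddCommGroup H] [InnerProductSpace ℂ H]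

/-- On a sum of eigenspaces of a symmetric operator, the quadratic form is diagonal. -/
theorem exists_eigenvector_decomposition {T : H →ₗ[ℂ] H} (hT : T.IsSymmetric) (S : Set ℝ) {x : H}
    (hx : x ∈ ⨆ (μ : ℝ) (_ : μ ∈ S), Module.End.eigenspace T (μ : ℂ)) :
    ∃ (s : Finset S) (f : S → H), RCLike.re ⟪T x, x⟫_ℂ = ∑ μ ∈ s, (μ : ℝ) * ‖f μ‖ ^ 2 ∧
      ‖x‖ ^ 2 = ∑ μ ∈ s, ‖f μ‖ ^ 2 := by
  rw [iSup_subtype', Submodule.mem_iSup_iff_exists_finsupp] at hx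
  obtain ⟨f, hf, rfl⟩ := hx
  have hV : OrthogonalFamily ℂ (fun μ : S => Module.End.eigenspace T ((μ : ℝ) : ℂ))
      fun μ => (Module.End.eigenspace T ((μ : ℝ) : ℂ)).subtypeₗᵢ :=
    hT.orthogonalFamily_eigenspaces.comp (γ := S) (f := fun μ => ((μ : ℝ) : ℂ))
      (Complex.ofReal_injective.comp Subtype.val_injective)
  let g : ∀ μ : S, Module.End.eigenspace T ((μ : ℝ) : ℂ) := fun μ => ⟨f μ, hf μ⟩
  have hsum : f.sum (fun _ y => y) = ∑ μ ∈ f.support, ((g μ : _) : H) := rfl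
  have hTg : ∀ μ, T (g μ) = ((μ : ℝ) : ℂ) • ((g μ : _) : H) := fun μ =>
    Module.End.mem_eigenspace_iff.mp (hf μ)
  refine ⟨f.support, f, ?_, ?_⟩
  · have h1 : T (f.sum fun _ y => y) =
        ∑ μ ∈ f.support, ((((μ : ℝ) : ℂ) • g μ : Module.End.eigenspace T ((μ : ℝ) : ℂ)) : H) := by
      rw [hsum, map_sum]
      exact Finset.sum_congr rfl fun μ _ => by simp [hTg]
    rw [h1, hsum]
    have h2 := hV.inner_sum (fun μ => ((μ : ℝ) : ℂ) • g μ) g f.support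
    simp only [Submodule.coe_subtypeₗᵢ, Submodule.coe_subtype] at h2
    rw [h2, map_sum]
    refine Finset.sum_congr rfl fun μ _ => ?_
    rw [inner_smul_left, inner_self_eq_norm_sq_to_K]
    simp only [Complex.conj_ofReal, RCLike.re_to_complex, Complex.coe_algebraMap]
    norm_cast
  · have h2 := hV.norm_sum g f.support
    simp only [Submodule.coe_subtypeₗᵢ, Submodule.coe_subtype] at h2
    rw [hsum, h2]
    rfl

/-- Strictness survives because the span is algebraic: a vector has finitely many components, each
with eigenvalue above `t`. The dimension counts below depend on this strictness. -/
theorem lt_re_inner_of_mem_upperEigenspace {T : H →L[ℂ] H}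
    (hT : (T : H →ₗ[ℂ] H).IsSymmetric) {t : ℝ} {x : H} (hx : x ∈ upperEigenspace T t)
    (h0 : x ≠ 0) : t * ‖x‖ ^ 2 < RCLike.re ⟪T x, x⟫_ℂ := by
  obtain ⟨s, f, h1, h2⟩ := exists_eigenvector_decomposition hT (Set.Ioi t) hx
  simp only [ContinuousLinearMap.coe_coe] at h1
  rw [h1, h2, Finset.mul_sum]
  have hpos : 0 < ∑ μ ∈ s, ‖f μ‖ ^ 2 := by rw [← h2]; positivity
  obtain ⟨μ, hμ, hμ0⟩ := Finset.exists_ne_zero_of_sum_ne_zero hpos.ne'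
  refine Finset.sum_lt_sum (fun ν _ => ?_) ⟨μ, hμ, ?_⟩
  · exact mul_le_mul_of_nonneg_right (le_of_lt ν.2) (by positivity)
  · exact mul_lt_mul_of_pos_right μ.2 (lt_of_le_of_ne (by positivity) (Ne.symm hμ0))

theorem le_re_inner_of_mem_upperEigenspace {T : H →L[ℂ] H}
    (hT : (T : H →ₗ[ℂ] H).IsSymmetric) {t : ℝ} {x : H} (hx : x ∈ upperEigenspace T t) :
    t * ‖x‖ ^ 2 ≤ RCLike.re ⟪T x, x⟫_ℂ := by
  rcases eq_or_ne x 0 with rfl | h0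
  · simp
  · exact (lt_re_inner_of_mem_upperEigenspace hT hx h0).le

theorem upperEigenspace_invariant (T : H →L[ℂ] H) (t : ℝ) {x : H}
    (hx : x ∈ upperEigenspace T t) : T x ∈ upperEigenspace T t := by
  have : upperEigenspace T t ≤ (upperEigenspace T t).comap (T : H →ₗ[ℂ] H) := by
    refine iSup₂_le fun μ hμ y hy => ?_
    rw [Submodule.mem_comap, Module.End.mem_eigenspace_iff.mp hy]
    exact Submodule.smul_mem _ _ (Submodule.mem_iSup_of_mem μ (Submodule.mem_iSup_of_mem hμ hy))
  exact this hx

variable [CompleteSpace H]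

/-- By the spectral theorem the eigenspaces span a dense subspace, so this orthogonal complement
lies in the closure of the span `W` of those with eigenvalue at most `t`. The bound is diagonal on
`W` and passes to the closure. -/
theorem re_inner_le_of_mem_upperEigenspace_orthogonal {T : H →L[ℂ] H}
    (hT : (T : H →ₗ[ℂ] H).IsSymmetric) (hc : IsCompactOperator T) {t : ℝ} {x : H}
    (hx : x ∈ (upperEigenspace T t)ᗮ) : RCLike.re ⟪T x, x⟫_ℂ ≤ t * ‖x‖ ^ 2 := by
  set W : Submodule ℂ H :=
    ⨆ (μ : ℝ) (_ : μ ∈ Set.Iic t), Module.End.eigenspace (T : H →ₗ[ℂ] H) (μ : ℂ) with hW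
  have hWq : ∀ y ∈ W.topologicalClosure, RCLike.re ⟪T y, y⟫_ℂ ≤ t * ‖y‖ ^ 2 := by
    intro y hy
    have hcl : IsClosed {y : H | RCLike.re ⟪T y, y⟫_ℂ ≤ t * ‖y‖ ^ 2} :=
      isClosed_le (by fun_prop) (by fun_prop)
    refine closure_minimal (fun z hz => ?_) hcl hy
    obtain ⟨s, f, h1, h2⟩ := exists_eigenvector_decomposition hT (Set.Iic t) hz
    simp only [ContinuousLinearMap.coe_coe] at h1
    rw [Set.mem_ofPred_eq, h1, h2, Finset.mul_sum]
    exact Finset.sum_le_sum fun ν _ => mul_le_mul_of_nonneg_right ν.2 (by positivity)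
  have hUW : upperEigenspace T t ⟂ W := by
    simp only [upperEigenspace, hW, Submodule.isOrtho_iSup_left, Submodule.isOrtho_iSup_right]
    refine fun μ hμ ν hν => hT.orthogonalFamily_eigenspaces.isOrtho fun h => ?_
    rw [Complex.ofReal_inj] at h
    subst h
    exact absurd (show t < ν from hν) (not_lt.mpr hμ)
  have htop : (upperEigenspace T t)ᗮ ⊓ Wᗮ = ⊥ := by
    rw [Submodule.inf_orthogonal, eq_bot_iff,
      ← ContinuousLinearMap.orthogonalComplement_iSup_eigenspaces_eq_bot hc hT]
    refine Submodule.orthogonal_le (iSup_le fun μ y hy => ?_)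
    by_cases h0 : y = 0
    · simp [h0]
    have hev : Module.End.HasEigenvalue (T : H →ₗ[ℂ] H) μ :=
      Module.End.hasEigenvalue_of_hasEigenvector ⟨hy, h0⟩
    have hμ : ((μ.re : ℝ) : ℂ) = μ := Complex.conj_eq_iff_re.mp (hT.conj_eigenvalue_eq_self hev)
    rw [← hμ] at hy
    rcases lt_or_ge t μ.re with h | h
    · exact Submodule.mem_sup_left
        (Submodule.mem_iSup_of_mem _ (Submodule.mem_iSup_of_mem h hy))
    · exact Submodule.mem_sup_right
        (Submodule.mem_iSup_of_mem _ (Submodule.mem_iSup_of_mem h hy))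
  have : CompleteSpace W.topologicalClosure :=
    W.isClosed_topologicalClosure.completeSpace_coe
  obtain ⟨y, hy, z, hz, rfl⟩ := W.topologicalClosure.exists_add_mem_mem_orthogonal x
  rw [Submodule.orthogonal_closure] at hz
  have hyU : y ∈ (upperEigenspace T t)ᗮ := by
    have : W.topologicalClosure ≤ (upperEigenspace T t)ᗮ :=
      Submodule.topologicalClosure_minimal _ hUW.symm (Submodule.isClosed_orthogonal _)
    exact this hy
  have hzU : z ∈ (upperEigenspace T t)ᗮ := by
    simpa using Submodule.sub_mem _ hx hyU
  have hz0 : z = 0 := by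
    have : z ∈ (upperEigenspace T t)ᗮ ⊓ Wᗮ := ⟨hzU, hz⟩
    simpa [htop] using this
  simpa [hz0] using hWq y hy

/-- On the closure of this space `T` is bounded below by `t`, hence a closed embedding. As `T` is
compact, it pulls back a compact set to a compact neighbourhood of `0`, and Riesz's theorem applies.
-/
theorem finiteDimensional_upperEigenspace {T : H →L[ℂ] H}
    (hT : (T : H →ₗ[ℂ] H).IsSymmetric) (hc : IsCompactOperator T) {t : ℝ} (ht : 0 < t) :
    FiniteDimensional ℂ (upperEigenspace T t) := by
  set C := (upperEigenspace T t).topologicalClosure with hC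
  have : CompleteSpace C := (upperEigenspace T t).isClosed_topologicalClosure.completeSpace_coe
  have hCq : ∀ y ∈ C, t * ‖y‖ ≤ ‖T y‖ := by
    intro y hy
    have hcl : IsClosed {y : H | t * ‖y‖ ≤ ‖T y‖} := isClosed_le (by fun_prop) (by fun_prop)
    refine closure_minimal (fun z hz => ?_) hcl hy
    rcases eq_or_ne z 0 with rfl | h0
    · simp
    have h1 := le_re_inner_of_mem_upperEigenspace hT hz
    have h2 : RCLike.re ⟪T z, z⟫_ℂ ≤ ‖T z‖ * ‖z‖ := re_inner_le_norm _ _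
    have h3 : 0 < ‖z‖ := norm_pos_iff.mpr h0
    show t * ‖z‖ ≤ ‖T z‖
    refine le_of_mul_le_mul_right ?_ h3
    nlinarith
  let A : C →L[ℂ] H := T ∘L C.subtypeL
  have hA : AntilipschitzWith (Real.toNNReal t⁻¹) A := by
    refine ContinuousLinearMap.antilipschitz_of_bound A fun x => ?_
    rw [Real.coe_toNNReal _ (by positivity), inv_mul_eq_div, le_div_iff₀ ht, mul_comm]
    exact hCq x x.2
  have hemb : Topology.IsClosedEmbedding A := hA.isClosedEmbedding A.uniformContinuous
  have hAc : IsCompactOperator A := hc.comp_clm C.subtypeL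
  obtain ⟨K, hK, hK0⟩ := hAc
  have : FiniteDimensional ℂ C :=
    FiniteDimensional.of_isCompactOperator_id ⟨A ⁻¹' K, hemb.isCompact_preimage hK, hK0⟩
  exact Submodule.finiteDimensional_of_le (Submodule.le_topologicalClosure _)

end Spectral

/-! ### Eigenspaces of powers through the functional calculus. -/

section Powers

variable {H : Type*} [NormedAddCommGroup H] [InnerProductSpace ℂ H]

theorem aeval_apply_eigenvector {B : H →L[ℂ] H} {x : H} {μ : ℝ} (hx : B x = (μ : ℂ) • x)
    (q : Polynomial ℝ) : (Polynomial.aeval B q) x = ((q.eval μ : ℝ) : ℂ) • x := by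
  induction q using Polynomial.induction_on' with
  | add p q hp hq => simp [hp, hq, add_smul]
  | monomial n r =>
    have hpow : ∀ n : ℕ, (B ^ n) x = ((μ : ℂ) ^ n) • x := by
      intro n
      induction n with
      | zero => simp
      | succ n ih => rw [pow_succ, mul_apply_eq_comp, hx, map_smul, ih, smul_smul,
          pow_succ, mul_comm]
    simp [Polynomial.aeval_monomial, hpow, Algebra.algebraMap_eq_smul_one, mul_smul]

variable [CompleteSpace H]

/-- The continuous functional calculus acts on eigenvectors through the eigenvalue. -/
theorem cfc_apply_eigenvector {B : H →L[ℂ] H} (hB : IsSelfAdjoint B) {f : ℝ → ℝ}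
    (hf : Continuous f) {x : H} {μ : ℝ} (hx : B x = (μ : ℂ) • x) :
    (cfc f B) x = (f μ : ℂ) • x := by
  rw [← sub_eq_zero, ← norm_eq_zero]
  refine le_antisymm (le_of_forall_pos_le_add fun ε hε => ?_) (norm_nonneg _)
  set M : ℝ := ‖B‖ + |μ|
  -- Two errors of size `δ * ‖x‖` have to fit into `ε`: the polynomial against `f` on the operator,
  -- and at `μ`. The `+ 1` covers `x = 0`.
  set δ : ℝ := ε / (2 * (‖x‖ + 1))
  have hδ : 0 < δ := by positivity
  obtain ⟨q, hq⟩ := exists_polynomial_near_of_continuousOn (-M) M f hf.continuousOn δ hδ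
  have h1 : ‖cfc f B - Polynomial.aeval B q‖ ≤ δ := by
    rw [← cfc_polynomial q B hB,
      ← cfc_sub (a := B) f (fun y => q.eval y) hf.continuousOn (by fun_prop)]
    refine norm_cfc_le hδ.le fun y hy => ?_
    have hy' : |y| ≤ M := by
      have hn : Nontrivial (H →L[ℂ] H) := by
        by_contra hn
        have := not_nontrivial_iff_subsingleton.mp hn
        simp [spectrum.of_subsingleton] at hy
      have : Nontrivial H := by
        by_contra hH
        have := not_nontrivial_iff_subsingleton.mp hH
        exact not_subsingleton (H →L[ℂ] H) inferInstance
      have := spectrum.norm_le_norm_of_mem hy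
      rw [Real.norm_eq_abs] at this
      exact this.trans (le_add_of_nonneg_right (abs_nonneg _))
    have := hq y (abs_le.mp hy')
    rw [Real.norm_eq_abs, abs_sub_comm]
    exact this.le
  have h2 : |q.eval μ - f μ| ≤ δ :=
    (hq μ (abs_le.mp (le_add_of_nonneg_left (norm_nonneg _)))).le
  have h3 : (cfc f B) x - (f μ : ℂ) • x = (cfc f B - Polynomial.aeval B q) x
      + ((q.eval μ - f μ : ℝ) : ℂ) • x := by
    rw [sub_apply, aeval_apply_eigenvector hx]
    push_cast
    rw [sub_smul]
    abel
  rw [h3]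
  have h4 : ‖(cfc f B - Polynomial.aeval B q) x‖ ≤ δ * ‖x‖ :=
    ContinuousLinearMap.le_of_opNorm_le _ h1 x
  have h5 : ‖((q.eval μ - f μ : ℝ) : ℂ) • x‖ ≤ δ * ‖x‖ := by
    rw [norm_smul, Complex.norm_real, Real.norm_eq_abs]
    gcongr
  have h6 : δ * (2 * (‖x‖ + 1)) = ε := by
    simp only [δ]
    field_simp
  nlinarith [norm_add_le ((cfc f B - Polynomial.aeval B q) x) (((q.eval μ - f μ : ℝ) : ℂ) • x)]

theorem rpow_apply_eigenvector {B : H →L[ℂ] H} (hB : 0 ≤ B) {r : ℝ} (hr : 0 ≤ r) {x : H} {μ : ℝ}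
    (hx : B x = (μ : ℂ) • x) : (B ^ r) x = ((μ ^ r : ℝ) : ℂ) • x := by
  rw [CFC.rpow_eq_cfc_real hB]
  exact cfc_apply_eigenvector hB.isSelfAdjoint (Real.continuous_rpow_const hr) hx

theorem upperEigenspace_le_rpow {B : H →L[ℂ] H} (hB : 0 ≤ B) {r : ℝ} (hr : 0 < r) {t : ℝ}
    (ht : 0 ≤ t) : upperEigenspace B t ≤ upperEigenspace (B ^ r) (t ^ r) := by
  refine iSup₂_le fun μ hμ x hx => ?_
  refine Submodule.mem_iSup_of_mem (μ ^ r)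
    (Submodule.mem_iSup_of_mem (Real.rpow_lt_rpow ht hμ hr) ?_)
  rw [Module.End.mem_eigenspace_iff] at hx ⊢
  exact rpow_apply_eigenvector hB hr.le hx

/-- The reverse inclusion is the forward one for `B ^ r` and the exponent `r⁻¹`. -/
theorem upperEigenspace_rpow {B : H →L[ℂ] H} (hB : 0 ≤ B) {r : ℝ} (hr : 0 < r) {t : ℝ}
    (ht : 0 ≤ t) : upperEigenspace (B ^ r) (t ^ r) = upperEigenspace B t := by
  refine le_antisymm ?_ (upperEigenspace_le_rpow hB hr ht)
  have h := upperEigenspace_le_rpow (B := B ^ r) CFC.rpow_nonneg (inv_pos.mpr hr)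
    (Real.rpow_nonneg ht r)
  rwa [CFC.rpow_rpow_of_exponent_nonneg B r r⁻¹ hr.le (inv_pos.mpr hr).le hB,
    ← Real.rpow_mul ht, mul_inv_cancel₀ hr.ne', Real.rpow_one, CFC.rpow_one B hB] at h

theorem abs_rpow_eq (a : H →L[ℂ] H) {p : ℝ} (hp : 0 ≤ p) :
    CFC.abs a ^ p = (star a * a) ^ (p / 2) := by
  rw [CFC.abs, CFC.sqrt_eq_rpow, CFC.rpow_rpow_of_exponent_nonneg _ _ _ (by norm_num) hp
    (star_mul_self_nonneg a)]
  congr 1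
  ring

theorem upperEigenspace_abs_rpow (a : H →L[ℂ] H) {p : ℝ} (hp : 0 < p) {t : ℝ} (ht : 0 ≤ t) :
    upperEigenspace (CFC.abs a ^ p) (t ^ p) = upperEigenspace (star a * a) (t ^ 2) := by
  rw [abs_rpow_eq a hp.le]
  have h : (t ^ 2) ^ (p / 2) = t ^ p := by
    rw [← Real.rpow_natCast, ← Real.rpow_mul ht, Nat.cast_ofNat, mul_div_cancel₀ _ two_ne_zero]
  rw [← h]
  exact upperEigenspace_rpow (star_mul_self_nonneg a) (half_pos hp) (sq_nonneg t)

end Powers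

/-! ### Approximation numbers: continuity, ideal inequalities, adjoints. -/

section ApproximationNumbers

variable {H : Type*} [NormedAddCommGroup H] [InnerProductSpace ℂ H]

/-- The `n`-th approximation number of a bounded operator: its distance to the operators of rank
at most `n`. -/
def approxNumber (a : H →L[ℂ] H) (n : ℕ) : ℝ≥0 :=
  ⨅ f : {f : H →L[ℂ] H // LinearMap.rank (f : H →ₗ[ℂ] H) ≤ n}, ‖a - f‖₊

theorem approxNumber_le (a : H →L[ℂ] H) {n : ℕ} {f : H →L[ℂ] H}
    (hf : LinearMap.rank (f : H →ₗ[ℂ] H) ≤ n) : approxNumber a n ≤ ‖a - f‖₊ :=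
  ciInf_le (OrderBot.bddBelow _)
    (⟨f, hf⟩ : {f : H →L[ℂ] H // LinearMap.rank (f : H →ₗ[ℂ] H) ≤ n})

instance (n : ℕ) : Nonempty {f : H →L[ℂ] H // LinearMap.rank (f : H →ₗ[ℂ] H) ≤ n} :=
  ⟨⟨0, by simp⟩⟩

theorem le_approxNumber {a : H →L[ℂ] H} {n : ℕ} {r : ℝ≥0}
    (h : ∀ f : H →L[ℂ] H, LinearMap.rank (f : H →ₗ[ℂ] H) ≤ n → r ≤ ‖a - f‖₊) :
    r ≤ approxNumber a n :=
  le_ciInf fun f => h f f.2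

theorem exists_of_approxNumber_lt {a : H →L[ℂ] H} {n : ℕ} {r : ℝ≥0} (h : approxNumber a n < r) :
    ∃ f : H →L[ℂ] H, LinearMap.rank (f : H →ₗ[ℂ] H) ≤ n ∧ ‖a - f‖₊ < r := by
  obtain ⟨f, hf⟩ := exists_lt_of_ciInf_lt h
  exact ⟨f, f.2, hf⟩

theorem approxNumber_antitone (a : H →L[ℂ] H) : Antitone (approxNumber a) := fun _ _ hmn =>
  le_approxNumber fun _ hf => approxNumber_le a (hf.trans (by exact_mod_cast hmn))

theorem approxNumber_zero_right (a : H →L[ℂ] H) : approxNumber a 0 = ‖a‖₊ := by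
  refine le_antisymm ?_ (le_approxNumber fun f hf => ?_)
  · simpa using approxNumber_le a (n := 0) (f := 0) (by simp)
  · have : LinearMap.range (f : H →ₗ[ℂ] H) = ⊥ := by
      simpa [LinearMap.rank, Submodule.rank_eq_zero] using hf
    have hf0 : f = 0 := by
      ext x
      exact LinearMap.congr_fun (LinearMap.range_eq_bot.mp this) x
    simp [hf0]

/-- A near-optimal approximant of `b` also serves for `a`. Exchanging the roles makes each
approximation number 1-Lipschitz. -/
theorem approxNumber_le_add (a b : H →L[ℂ] H) (n : ℕ) :
    approxNumber a n ≤ approxNumber b n + ‖a - b‖₊ := by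
  refine le_of_forall_pos_le_add fun ε hε => ?_
  obtain ⟨f, hf, h⟩ := exists_of_approxNumber_lt (lt_add_of_pos_right (approxNumber b n) hε)
  calc approxNumber a n ≤ ‖a - f‖₊ := approxNumber_le a hf
    _ = ‖(b - f) + (a - b)‖₊ := by congr 1; abel
    _ ≤ ‖b - f‖₊ + ‖a - b‖₊ := nnnorm_add_le _ _
    _ ≤ approxNumber b n + ε + ‖a - b‖₊ := by gcongr
    _ = approxNumber b n + ‖a - b‖₊ + ε := add_right_comm _ _ _

theorem continuous_approxNumber (n : ℕ) :
    Continuous fun a : H →L[ℂ] H => approxNumber a n := by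
  refine (LipschitzWith.of_dist_le_mul (K := 1) fun a b => ?_).continuous
  rw [NNReal.dist_eq, NNReal.coe_one, one_mul, dist_eq_norm, abs_sub_le_iff]
  have h1 : (approxNumber a n : ℝ) ≤ approxNumber b n + ‖a - b‖ := approxNumber_le_add a b n
  have h2 : (approxNumber b n : ℝ) ≤ approxNumber a n + ‖b - a‖ := approxNumber_le_add b a n
  rw [norm_sub_rev] at h2
  constructor <;> linarith

theorem approxNumber_mul_le_right (a b : H →L[ℂ] H) (n : ℕ) :
    approxNumber (a * b) n ≤ approxNumber a n * ‖b‖₊ := by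
  rw [approxNumber, approxNumber, NNReal.iInf_mul]
  refine le_ciInf fun f => ?_
  refine (approxNumber_le (a * b) (f := f.1 * b)
    ((LinearMap.rank_comp_le_left (b : H →ₗ[ℂ] H) (f.1 : H →ₗ[ℂ] H)).trans f.2)).trans ?_
  rw [← sub_mul]
  exact nnnorm_mul_le _ _

theorem approxNumber_mul_le_left (a b : H →L[ℂ] H) (n : ℕ) :
    approxNumber (b * a) n ≤ ‖b‖₊ * approxNumber a n := by
  rw [approxNumber, approxNumber, NNReal.mul_iInf]
  refine le_ciInf fun f => ?_
  refine (approxNumber_le (b * a) (f := b * f.1)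
    ((LinearMap.rank_comp_le_right (f.1 : H →ₗ[ℂ] H) (b : H →ₗ[ℂ] H)).trans f.2)).trans ?_
  rw [← mul_sub]
  exact nnnorm_mul_le _ _

theorem approxNumber_smul_le (c : ℂ) (a : H →L[ℂ] H) (n : ℕ) :
    approxNumber (c • a) n ≤ ‖c‖₊ * approxNumber a n := by
  have h : c • a = (c • (1 : H →L[ℂ] H)) * a := by rw [smul_mul_assoc, one_mul]
  have h1 : ‖c • (1 : H →L[ℂ] H)‖₊ ≤ ‖c‖₊ := by
    rw [nnnorm_smul]
    exact mul_le_of_le_one_right' (ContinuousLinearMap.norm_id_le (𝕜 := ℂ) (E := H))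
  rw [h]
  exact (approxNumber_mul_le_left a _ n).trans (by gcongr)

theorem approxNumber_smul (c : ℂ) (a : H →L[ℂ] H) (n : ℕ) :
    approxNumber (c • a) n = ‖c‖₊ * approxNumber a n := by
  refine le_antisymm (approxNumber_smul_le c a n) ?_
  rcases eq_or_ne c 0 with rfl | hc
  · simp
  · have h := approxNumber_smul_le c⁻¹ (c • a) n
    rw [smul_smul, inv_mul_cancel₀ hc, one_smul, nnnorm_inv] at h
    calc ‖c‖₊ * approxNumber a n ≤ ‖c‖₊ * (‖c‖₊⁻¹ * approxNumber (c • a) n) := by gcongr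
      _ = approxNumber (c • a) n := by
        rw [← mul_assoc, mul_inv_cancel₀ (by simpa using hc), one_mul]

/-- An operator of rank at most `n` vanishes at some non-zero vector of any subspace of dimension
greater than `n`. -/
theorem exists_ne_zero_apply_eq_zero {E : Type*} [AddCommGroup E] [Module ℂ E]
    {f : H →L[ℂ] H} {n : ℕ} (hf : LinearMap.rank (f : H →ₗ[ℂ] H) ≤ n) (V : E →ₗ[ℂ] H)
    (hE : ¬ Module.rank ℂ E ≤ n) : ∃ x : E, x ≠ 0 ∧ f (V x) = 0 := by
  by_contra! h
  apply hE
  let g : E →ₗ[ℂ] LinearMap.range (f : H →ₗ[ℂ] H) := (f : H →ₗ[ℂ] H).rangeRestrict ∘ₗ V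
  have hg : Function.Injective g := by
    rw [← LinearMap.ker_eq_bot, LinearMap.ker_eq_bot']
    intro x hx
    by_contra hx0
    exact h x hx0 (congrArg Subtype.val hx)
  have h1 := LinearMap.lift_rank_le_of_injective g hg
  have h2 := h1.trans (Cardinal.lift_le.mpr hf)
  simpa using h2

theorem finiteDimensional_range_of_rank_le {f : H →L[ℂ] H} {n : ℕ}
    (hf : LinearMap.rank (f : H →ₗ[ℂ] H) ≤ n) :
    FiniteDimensional ℂ (LinearMap.range (f : H →ₗ[ℂ] H)) :=
  Module.rank_lt_aleph0_iff.mp (hf.trans_lt Cardinal.natCast_lt_aleph0)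

variable [CompleteSpace H]

/-- Taking adjoints in `P f = f`. It shows that the adjoint factors through the range of `f`, so its
rank does not exceed that of `f`. -/
theorem star_eq_star_mul_starProjection_range (f : H →L[ℂ] H)
    [FiniteDimensional ℂ (LinearMap.range (f : H →ₗ[ℂ] H))] :
    star f = star f * (LinearMap.range (f : H →ₗ[ℂ] H)).starProjection := by
  set F := LinearMap.range (f : H →ₗ[ℂ] H)
  have h : F.starProjection * f = f := by
    ext x
    exact Submodule.starProjection_eq_self_iff.mpr (LinearMap.mem_range_self (f : H →ₗ[ℂ] H) x)
  conv_lhs => rw [← h, star_mul]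
  rw [(isSelfAdjoint_starProjection F).star_eq]

theorem approxNumber_star_le (a : H →L[ℂ] H) (n : ℕ) :
    approxNumber (star a) n ≤ approxNumber a n := by
  refine le_approxNumber fun f hf => ?_
  have hfin := finiteDimensional_range_of_rank_le hf
  set F := LinearMap.range (f : H →ₗ[ℂ] H)
  have h : LinearMap.rank ((star f : H →L[ℂ] H) : H →ₗ[ℂ] H) ≤ n := by
    rw [star_eq_star_mul_starProjection_range f]
    refine (LinearMap.rank_comp_le_right (F.starProjection : H →ₗ[ℂ] H)
      ((star f : H →L[ℂ] H) : H →ₗ[ℂ] H)).trans (le_trans ?_ hf)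
    refine Submodule.rank_mono ?_
    rintro _ ⟨x, rfl⟩
    exact F.starProjection_apply_mem x
  have := approxNumber_le (star a) h
  rwa [← star_sub, nnnorm_star] at this

theorem approxNumber_star (a : H →L[ℂ] H) (n : ℕ) :
    approxNumber (star a) n = approxNumber a n :=
  le_antisymm (approxNumber_star_le a n) (by simpa using approxNumber_star_le (star a) n)

end ApproximationNumbers

/-! ### Approximation numbers as singular values. -/

section Singular

variable {H : Type*} [NormedAddCommGroup H] [InnerProductSpace ℂ H]

theorem upperEigenspace_mono (T : H →L[ℂ] H) {s t : ℝ} (hst : s ≤ t) :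
    upperEigenspace T t ≤ upperEigenspace T s :=
  iSup₂_le fun μ hμ => le_iSup₂_of_le μ (hst.trans_lt hμ) le_rfl

theorem norm_sum_sq_of_pairwise_orthogonal {E ι : Type*} [NormedAddCommGroup E]
    [InnerProductSpace ℂ E] (s : Finset ι) {g : ι → E} (hg : ∀ i j, i ≠ j → ⟪g i, g j⟫_ℂ = 0)
    (c : ι → ℂ) : ‖∑ i ∈ s, c i • g i‖ ^ 2 = ∑ i ∈ s, ‖c i‖ ^ 2 * ‖g i‖ ^ 2 := by
  have h : ⟪∑ i ∈ s, c i • g i, ∑ i ∈ s, c i • g i⟫_ℂ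
      = ∑ i ∈ s, ⟪c i • g i, c i • g i⟫_ℂ := by
    rw [sum_inner]
    refine Finset.sum_congr rfl fun i hi => ?_
    rw [inner_sum]
    refine Finset.sum_eq_single_of_mem i hi fun j _ hj => ?_
    rw [inner_smul_left, inner_smul_right, hg i j hj.symm, mul_zero, mul_zero]
  rw [← inner_self_eq_norm_sq (𝕜 := ℂ), h, map_sum]
  refine Finset.sum_congr rfl fun i _ => ?_
  rw [inner_self_eq_norm_sq, norm_smul, mul_pow]

/-- An operator `f` of rank at most `j` kills a non-zero vector of the `(j + 1)`-dimensional span,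
where `a - f` agrees with `a`. -/
theorem le_approxNumber_of_orthonormal {a : H →L[ℂ] H} {j : ℕ} {r : ℝ≥0} {w : Fin (j + 1) → H}
    (hw : Orthonormal ℂ w)
    (h : ∀ c : Fin (j + 1) → ℂ, (r : ℝ) ^ 2 * ∑ i, ‖c i‖ ^ 2 ≤ ‖a (∑ i, c i • w i)‖ ^ 2) :
    r ≤ approxNumber a j := by
  refine le_approxNumber fun f hf => ?_
  obtain ⟨c, hc0, hc⟩ := exists_ne_zero_apply_eq_zero hf (Fintype.linearCombination ℂ w)
    (by rw [rank_fin_fun]; exact_mod_cast not_le.mpr (Nat.lt_succ_self j))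
  rw [Fintype.linearCombination_apply] at hc
  have hnorm : ‖∑ i, c i • w i‖ ^ 2 = ∑ i, ‖c i‖ ^ 2 := by
    rw [norm_sum_sq_of_pairwise_orthogonal _ (fun i k hik => hw.2 hik)]
    simp [hw.1]
  have hpos : 0 < ‖∑ i, c i • w i‖ := by
    rw [norm_pos_iff]
    intro h0
    apply hc0
    rw [h0, norm_zero, zero_pow two_ne_zero, eq_comm,
      Finset.sum_eq_zero_iff_of_nonneg (fun _ _ => by positivity)] at hnorm
    ext i
    simpa using hnorm i (Finset.mem_univ i)
  have h1 := h c
  rw [← hnorm, ← mul_pow] at h1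
  have h2 := le_of_pow_le_pow_left₀ two_ne_zero (norm_nonneg _) h1
  have h3 : a (∑ i, c i • w i) = (a - f) (∑ i, c i • w i) := by rw [sub_apply, hc, sub_zero]
  rw [h3] at h2
  have h4 := h2.trans ((a - f).le_opNorm _)
  exact NNReal.coe_le_coe.mp (le_of_mul_le_mul_right h4 hpos)

theorem exists_linearIsometry_apply_eq {E : Type*} [NormedAddCommGroup E] [InnerProductSpace ℂ E]
    {k : ℕ} (c : OrthonormalBasis (Fin k) ℂ E) {w : Fin k → H} (hw : Orthonormal ℂ w) :
    ∃ W : E →ₗᵢ[ℂ] H, ∀ j, W (c j) = w j := by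
  have hc : ∀ j, c.toBasis.constr ℂ w (c.toBasis j) = w j := c.toBasis.constr_basis ℂ w
  refine ⟨LinearMap.isometryOfOrthonormal (c.toBasis.constr ℂ w) (v := c.toBasis)
    (by simp [c.orthonormal]) (by rwa [show _ ∘ _ = w from funext hc]), fun j => ?_⟩
  have h := hc j
  rw [c.coe_toBasis] at h
  exact h

variable [CompleteSpace H]

theorem inner_star_mul_self_apply (a : H →L[ℂ] H) (x y : H) :
    ⟪(star a * a) x, y⟫_ℂ = ⟪a x, a y⟫_ℂ := by
  rw [mul_apply_eq_comp, ContinuousLinearMap.star_eq_adjoint,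
    ContinuousLinearMap.adjoint_inner_left]

theorem re_inner_star_mul_self_apply (a : H →L[ℂ] H) (x : H) :
    RCLike.re ⟪(star a * a) x, x⟫_ℂ = ‖a x‖ ^ 2 := by
  rw [inner_star_mul_self_apply, inner_self_eq_norm_sq]

theorem isSymmetric_star_mul_self (a : H →L[ℂ] H) :
    ((star a * a : H →L[ℂ] H) : H →ₗ[ℂ] H).IsSymmetric :=
  (IsSelfAdjoint.star_mul_self a).isSymmetric

theorem isCompactOperator_star_mul_self {a : H →L[ℂ] H} (ha : IsCompactOperator a) :
    IsCompactOperator (star a * a : H →L[ℂ] H) :=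
  ha.clm_comp (star a)

/-- The bridge between eigenvalue counting and approximation, through `‖a x‖ ^ 2 = ⟪a* a x, x⟫`.
Cutting `a` off to the spectral subspace gives an approximant. Conversely, were the dimension larger
than `n`, `f` would kill a non-zero `x` there, with `‖(a - f) x‖ = ‖a x‖ > t ‖x‖`. -/
theorem rank_upperEigenspace_le_iff {a : H →L[ℂ] H} (ha : IsCompactOperator a) {t : ℝ}
    (ht : 0 < t) (n : ℕ) :
    Module.rank ℂ (upperEigenspace (star a * a) (t ^ 2)) ≤ n ↔
      ∃ f : H →L[ℂ] H, LinearMap.rank (f : H →ₗ[ℂ] H) ≤ n ∧ ‖a - f‖ ≤ t := by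
  set U := upperEigenspace (star a * a) (t ^ 2) with hU
  constructor
  · intro h
    have : FiniteDimensional ℂ U := finiteDimensional_upperEigenspace
      (isSymmetric_star_mul_self a) (isCompactOperator_star_mul_self ha) (by positivity)
    refine ⟨a * U.starProjection, ?_, ?_⟩
    · refine (LinearMap.rank_comp_le_right (U.starProjection : H →ₗ[ℂ] H)
        (a : H →ₗ[ℂ] H)).trans (le_trans ?_ h)
      refine Submodule.rank_mono ?_
      rintro _ ⟨x, rfl⟩
      exact U.starProjection_apply_mem x
    · refine ContinuousLinearMap.opNorm_le_bound _ ht.le fun x => ?_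
      have h1 : (a - a * U.starProjection) x = a (x - U.starProjection x) := by
        rw [sub_apply, mul_apply_eq_comp, map_sub]
      have h2 := re_inner_le_of_mem_upperEigenspace_orthogonal (isSymmetric_star_mul_self a)
        (isCompactOperator_star_mul_self ha) (U.sub_starProjection_mem_orthogonal x)
      rw [re_inner_star_mul_self_apply, ← mul_pow] at h2
      have h3 := le_of_pow_le_pow_left₀ two_ne_zero (by positivity) h2
      have h4 : ‖x - U.starProjection x‖ ≤ ‖x‖ := by
        have h5 := U.norm_sq_eq_add_norm_sq_starProjection x
        rw [Submodule.starProjection_orthogonal', sub_apply, one_apply_eq_self] at h5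
        exact le_of_pow_le_pow_left₀ two_ne_zero (norm_nonneg _)
          (by nlinarith [sq_nonneg ‖U.starProjection x‖])
      rw [h1]
      exact h3.trans (by gcongr)
  · rintro ⟨f, hf, hft⟩
    by_contra hn
    obtain ⟨x, hx0, hx⟩ := exists_ne_zero_apply_eq_zero hf U.subtype hn
    have h1 := lt_re_inner_of_mem_upperEigenspace (isSymmetric_star_mul_self a) x.2
      (by simpa using hx0)
    have h2 : a x = (a - f) x := by
      rw [sub_apply, show f x = 0 from hx, sub_zero]
    rw [re_inner_star_mul_self_apply, h2, ← mul_pow] at h1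
    have h3 : ‖(a - f) x‖ ≤ t * ‖(x : H)‖ := ContinuousLinearMap.le_of_opNorm_le _ hft x
    exact absurd h1 (not_lt.mpr (by gcongr))

/-- The eigenvalues of `|a|^p` are the `p`-th powers of the approximation numbers of `a`. -/
theorem eigenvalueSeq_abs_rpow {a : H →L[ℂ] H} (ha : IsCompactOperator a) {p : ℝ} (hp : 0 < p)
    (n : ℕ) : eigenvalueSeq (CFC.abs a ^ p) n = (approxNumber a n : ℝ) ^ p := by
  have hmem : ∀ r : ℝ, 0 < r → (Module.rank ℂ (upperEigenspace (CFC.abs a ^ p) (r ^ p)) ≤ n ↔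
      ∃ f : H →L[ℂ] H, LinearMap.rank (f : H →ₗ[ℂ] H) ≤ n ∧ ‖a - f‖ ≤ r) := fun r hr => by
    rw [upperEigenspace_abs_rpow a hp hr.le, rank_upperEigenspace_le_iff ha hr]
  have hgt : ∀ r : ℝ, (approxNumber a n : ℝ) < r →
      r ^ p ∈ {t : ℝ | 0 < t ∧ Module.rank ℂ (upperEigenspace (CFC.abs a ^ p) t) ≤ n} := by
    intro r hr
    have hr0 : 0 < r := (NNReal.coe_nonneg _).trans_lt hr
    refine ⟨Real.rpow_pos_of_pos hr0 p, (hmem r hr0).mpr ?_⟩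
    lift r to ℝ≥0 using hr0.le
    obtain ⟨f, hf, h⟩ := exists_of_approxNumber_lt (NNReal.coe_lt_coe.mp hr)
    exact ⟨f, hf, NNReal.coe_le_coe.mpr h.le⟩
  refine IsGLB.csInf_eq ⟨?_, ?_⟩ ⟨_, hgt _ (lt_add_one _)⟩
  · rintro t ⟨ht, h⟩
    have hs : (t ^ p⁻¹) ^ p = t := Real.rpow_inv_rpow ht.le hp.ne'
    rw [← hs, hmem _ (Real.rpow_pos_of_pos ht _)] at h
    obtain ⟨f, hf, hft⟩ := h
    rw [← hs]
    refine Real.rpow_le_rpow (NNReal.coe_nonneg _) (le_trans ?_ hft) hp.le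
    exact NNReal.coe_le_coe.mpr (approxNumber_le a hf)
  -- The infimum in `approxNumber` is not known to be attained, so the value is approached from the
  -- right.
  · intro b hb
    have hlim : Filter.Tendsto (fun r : ℝ => r ^ p)
        (nhdsWithin (approxNumber a n : ℝ) (Set.Ioi (approxNumber a n : ℝ)))
        (nhds ((approxNumber a n : ℝ) ^ p)) :=
      ((Real.continuous_rpow_const hp.le).tendsto _).mono_left nhdsWithin_le_nhds
    exact ge_of_tendsto hlim (Filter.eventually_of_mem self_mem_nhdsWithin
      fun r hr => hb (hgt r hr))

theorem tendsto_approxNumber {a : H →L[ℂ] H} (ha : IsCompactOperator a) :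
    Filter.Tendsto (approxNumber a) Filter.atTop (nhds 0) := by
  refine tendsto_order.mpr ⟨fun b hb => absurd hb not_lt_zero, fun ε hε => ?_⟩
  obtain ⟨t, ht0, htε⟩ := exists_between hε
  have : FiniteDimensional ℂ (upperEigenspace (star a * a) ((t : ℝ) ^ 2)) :=
    finiteDimensional_upperEigenspace (isSymmetric_star_mul_self a)
      (isCompactOperator_star_mul_self ha) (by positivity)
  obtain ⟨f, hf, hft⟩ := (rank_upperEigenspace_le_iff ha (NNReal.coe_pos.mpr ht0) _).mp
    (Module.finrank_eq_rank ℂ (upperEigenspace (star a * a) ((t : ℝ) ^ 2))).ge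
  filter_upwards [Filter.eventually_ge_atTop
    (Module.finrank ℂ (upperEigenspace (star a * a) ((t : ℝ) ^ 2)))] with n hn
  exact ((approxNumber_antitone a hn).trans (approxNumber_le a hf)).trans_lt
    (lt_of_le_of_lt (NNReal.coe_le_coe.mp hft) htε)

end Singular

/-! ### Singular vectors and Ky Fan's inequality. -/

section KyFan

variable {H : Type*} [NormedAddCommGroup H] [InnerProductSpace ℂ H] [CompleteSpace H]

/-- The initial part of the singular value decomposition of a compact operator. -/
theorem exists_singular_vectors {a : H →L[ℂ] H} (ha : IsCompactOperator a) {k : ℕ}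
    (hk : 0 < approxNumber a k) :
    ∃ v u : Fin (k + 1) → H, Orthonormal ℂ v ∧ Orthonormal ℂ u ∧
      ∀ j, a (v j) = ((approxNumber a j : ℝ) : ℂ) • u j := by
  -- Any `t` in this gap works: positivity makes `U` finite-dimensional, and `t < approxNumber a k`
  -- forces its dimension above `k`.
  obtain ⟨t, ht0, htk⟩ := exists_between hk
  set T := star a * a with hT
  have hTs : (T : H →ₗ[ℂ] H).IsSymmetric := isSymmetric_star_mul_self a
  set U := upperEigenspace T ((t : ℝ) ^ 2) with hU
  have hfin : FiniteDimensional ℂ U := finiteDimensional_upperEigenspace hTs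
    (isCompactOperator_star_mul_self ha) (by positivity)
  have hkm : k < Module.finrank ℂ U := by
    by_contra! h
    have hr : Module.rank ℂ U ≤ k := by
      rw [← Module.finrank_eq_rank]
      exact_mod_cast h
    obtain ⟨f, hf, hft⟩ := (rank_upperEigenspace_le_iff ha (NNReal.coe_pos.mpr ht0) k).mp hr
    exact absurd htk (not_lt.mpr ((approxNumber_le a hf).trans hft))
  set m := Module.finrank ℂ U with hm
  have hinv : ∀ x ∈ U, (T : H →ₗ[ℂ] H) x ∈ U := fun x hx => upperEigenspace_invariant T _ hx
  have hS : ((T : H →ₗ[ℂ] H).restrict hinv).IsSymmetric := hTs.restrict_invariant hinv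
  set e := hS.eigenvectorBasis hm.symm with he
  set μ := hS.eigenvalues hm.symm with hμ
  have hTe : ∀ i, T (e i : H) = (μ i : ℂ) • (e i : H) := fun i =>
    congrArg Subtype.val (hS.apply_eigenvectorBasis hm.symm i)
  have heo : Orthonormal ℂ fun i => (e i : H) := e.orthonormal.comp_linearIsometry U.subtypeₗᵢ
  have hinner : ∀ i j, i ≠ j → ⟪a (e i : H), a (e j : H)⟫_ℂ = 0 := by
    intro i j hij
    rw [← inner_star_mul_self_apply, hTe, inner_smul_left, heo.2 hij, mul_zero]
  have hnorm : ∀ i, ‖a (e i : H)‖ ^ 2 = μ i := by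
    intro i
    rw [← re_inner_star_mul_self_apply, hTe, inner_smul_left, inner_self_eq_norm_sq_to_K,
      heo.1 i]
    simp
  have hμt : ∀ i, (t : ℝ) ^ 2 < μ i := by
    intro i
    have h := lt_re_inner_of_mem_upperEigenspace hTs (e i).2 (heo.ne_zero i)
    rwa [re_inner_star_mul_self_apply, hnorm, heo.1 i, one_pow, mul_one] at h
  have hμ0 : ∀ i, 0 < μ i := fun i => (by positivity : (0 : ℝ) ≤ (t : ℝ) ^ 2).trans_lt (hμt i)
  have hanti : Antitone μ := hS.eigenvalues_antitone hm.symm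
  -- On the span of `e 0, …, e i` the operator `a` stretches by at least `‖a (e i)‖`, as `μ`
  -- decreases.
  have hlow : ∀ i : Fin m, ‖a (e i : H)‖₊ ≤ approxNumber a i := by
    intro i
    have hlt : ∀ l : Fin (i + 1), (l : ℕ) < m := fun l => by omega
    have hinj : Function.Injective fun l : Fin (i + 1) => (⟨l, hlt l⟩ : Fin m) := fun l l' h =>
      Fin.ext (congrArg (Fin.val (n := m)) h)
    refine le_approxNumber_of_orthonormal (w := fun l => (e ⟨l, hlt l⟩ : H))
      (heo.comp _ hinj) fun c => ?_
    rw [map_sum]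
    simp only [map_smul]
    rw [norm_sum_sq_of_pairwise_orthogonal _
      (fun l l' h => hinner _ _ (hinj.ne h)), Finset.mul_sum, coe_nnnorm, hnorm]
    refine Finset.sum_le_sum fun l _ => ?_
    rw [hnorm, mul_comm]
    gcongr
    exact hanti (Fin.mk_le_of_le_val (by omega))
  have hupp : ∀ i : Fin m, approxNumber a i ≤ ‖a (e i : H)‖₊ := by
    intro i
    have hpos : 0 < ‖a (e i : H)‖ := by
      have := hnorm i ▸ hμ0 i
      exact lt_of_le_of_ne (norm_nonneg _) fun h => by simp [← h] at this
    suffices hr : Module.rank ℂ (upperEigenspace T (‖a (e i : H)‖ ^ 2)) ≤ (i : ℕ) by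
      obtain ⟨f, hf, hft⟩ := (rank_upperEigenspace_le_iff ha hpos i).mp hr
      exact (approxNumber_le a hf).trans hft
    by_contra hr
    -- A spectral subspace of dimension above `i` contains a non-zero `x` orthogonal to `e 0, …, e
    -- (i - 1)`. Only coefficients with `μ l ≤ μ i` remain, so `‖a x‖ ^ 2 ≤ μ i * ‖x‖ ^ 2`, against
    -- the strict bound `h1`.
    set F : Submodule ℂ H :=
      Submodule.span ℂ (Set.range fun l : Fin i => (e ⟨l, l.2.trans i.2⟩ : H)) with hF
    have hFfin : FiniteDimensional ℂ F := FiniteDimensional.span_of_finite ℂ (Set.finite_range _)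
    have hFr : LinearMap.rank (F.starProjection : H →ₗ[ℂ] H) ≤ (i : ℕ) := by
      have h1 : Module.rank ℂ F ≤ (i : ℕ) := by
        rw [← Module.finrank_eq_rank]
        have := finrank_range_le_card (R := ℂ) fun l : Fin i => (e ⟨l, l.2.trans i.2⟩ : H)
        rw [Fintype.card_fin] at this
        exact_mod_cast this
      refine le_trans (Submodule.rank_mono ?_) h1
      rintro _ ⟨x, rfl⟩
      exact F.starProjection_apply_mem x
    obtain ⟨⟨x, hx⟩, hx0, hPx⟩ := exists_ne_zero_apply_eq_zero hFr (Submodule.subtype _) hr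
    have hx0' : x ≠ 0 := by simpa using hx0
    have hxF : x ∈ Fᗮ := by
      have := F.sub_starProjection_mem_orthogonal x
      rwa [show F.starProjection x = 0 from hPx, sub_zero] at this
    have hxU : x ∈ U := upperEigenspace_mono T (by rw [hnorm]; exact (hμt i).le) hx
    have h1 := lt_re_inner_of_mem_upperEigenspace hTs hx hx0'
    rw [re_inner_star_mul_self_apply, hnorm] at h1
    set c : Fin m → ℂ := fun l => ⟪e l, (⟨x, hxU⟩ : U)⟫_ℂ with hc
    have hxc : x = ∑ l, c l • (e l : H) := by
      have := congrArg Subtype.val (e.sum_repr' (⟨x, hxU⟩ : U))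
      simpa [hc] using this.symm
    have hc0 : ∀ l : Fin m, l < i → c l = 0 := fun l hl =>
      hxF _ (Submodule.subset_span ⟨⟨l, hl⟩, rfl⟩)
    have h2 : ‖a x‖ ^ 2 = ∑ l, ‖c l‖ ^ 2 * μ l := by
      conv_lhs => rw [hxc, map_sum]
      simp only [map_smul]
      rw [norm_sum_sq_of_pairwise_orthogonal _ hinner]
      simp only [hnorm]
    have h3 : ‖x‖ ^ 2 = ∑ l, ‖c l‖ ^ 2 := by
      conv_lhs => rw [hxc]
      rw [norm_sum_sq_of_pairwise_orthogonal _ fun l l' h => heo.2 h]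
      simp [heo.1]
    rw [h2, h3, Finset.mul_sum] at h1
    refine absurd h1 (not_lt.mpr (Finset.sum_le_sum fun l _ => ?_))
    rcases lt_or_ge l i with hl | hl
    · simp [hc0 l hl]
    · rw [mul_comm]
      gcongr
      exact hanti hl
  have heq : ∀ i : Fin m, (approxNumber a i : ℝ) = ‖a (e i : H)‖ := fun i =>
    congrArg NNReal.toReal (le_antisymm (hupp i) (hlow i))
  have hlt : ∀ j : Fin (k + 1), (j : ℕ) < m := fun j => by omega
  have hinj : Function.Injective fun j : Fin (k + 1) => (⟨j, hlt j⟩ : Fin m) := fun l l' h =>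
    Fin.ext (congrArg (Fin.val (n := m)) h)
  have hne : ∀ i : Fin m, ((‖a (e i : H)‖ : ℝ) : ℂ) ≠ 0 := by
    intro i h
    have h' : ‖a (e i : H)‖ = 0 := by exact_mod_cast h
    have := hμ0 i
    rw [← hnorm, h'] at this
    simp at this
  refine ⟨fun j => e ⟨j, hlt j⟩,
    fun j => ((‖a (e ⟨j, hlt j⟩ : H)‖ : ℝ) : ℂ)⁻¹ • a (e ⟨j, hlt j⟩ : H),
    heo.comp _ hinj, ⟨fun j => ?_, fun j l hjl => ?_⟩, fun j => ?_⟩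
  · rw [norm_smul, norm_inv, Complex.norm_real, norm_norm]
    exact inv_mul_cancel₀ fun h => hne ⟨j, hlt j⟩ (by exact_mod_cast h)
  · simp only [inner_smul_left, inner_smul_right]
    rw [hinner _ _ (hinj.ne hjl), mul_zero, mul_zero]
  · rw [heq ⟨j, hlt j⟩, smul_smul, mul_inv_cancel₀ (hne _), one_smul]

/-- The sum is the trace of the compression `M = W* a V`, hence may be computed in an eigenbasis `e`
of `M* M`. There each diagonal entry is at most `‖M (e j)‖`, the `j`-th singular value of `M`, which
`approxNumber a j` dominates. -/
theorem norm_sum_inner_linearIsometry_le (a : H →L[ℂ] H) {E : Type*} [NormedAddCommGroup E]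
    [InnerProductSpace ℂ E] [FiniteDimensional ℂ E] {k : ℕ} (c : OrthonormalBasis (Fin k) ℂ E)
    (V W : E →ₗᵢ[ℂ] H) :
    ‖∑ j, ⟪W (c j), a (V (c j))⟫_ℂ‖ ≤ ∑ j : Fin k, (approxNumber a j : ℝ) := by
  have : CompleteSpace E := FiniteDimensional.complete ℂ E
  let M : E →L[ℂ] E := W.toContinuousLinearMap.adjoint ∘L a ∘L V.toContinuousLinearMap
  have hM : ∀ x y : E, ⟪x, M y⟫_ℂ = ⟪W x, a (V y)⟫_ℂ := fun x y =>
    ContinuousLinearMap.adjoint_inner_right W.toContinuousLinearMap x (a (V y))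
  have hMle : ∀ x, ‖M x‖ ≤ ‖a (V x)‖ := by
    intro x
    refine ((W.toContinuousLinearMap.adjoint).le_opNorm _).trans ?_
    rw [LinearIsometryEquiv.norm_map]
    exact mul_le_of_le_one_left (norm_nonneg _) W.norm_toContinuousLinearMap_le
  have hsym := isSymmetric_star_mul_self M
  have hrank : Module.finrank ℂ E = k := by
    rw [Module.finrank_eq_card_basis c.toBasis, Fintype.card_fin]
  set e := hsym.eigenvectorBasis hrank
  set μ := hsym.eigenvalues hrank
  have hSe : ∀ i, (star M * M) (e i) = (μ i : ℂ) • e i := hsym.apply_eigenvectorBasis hrank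
  have hinner : ∀ i j, i ≠ j → ⟪M (e i), M (e j)⟫_ℂ = 0 := by
    intro i j hij
    rw [← inner_star_mul_self_apply, hSe, inner_smul_left, e.orthonormal.2 hij, mul_zero]
  have hnorm : ∀ i, ‖M (e i)‖ ^ 2 = μ i := by
    intro i
    rw [← re_inner_star_mul_self_apply, hSe, inner_smul_left, inner_self_eq_norm_sq_to_K,
      e.orthonormal.1 i]
    simp
  have hanti : Antitone μ := hsym.eigenvalues_antitone hrank
  have hle : ∀ i : Fin k, ‖M (e i)‖₊ ≤ approxNumber a i := by
    intro i
    have hlt : ∀ l : Fin (i + 1), (l : ℕ) < k := fun l => by omega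
    have hinj : Function.Injective fun l : Fin (i + 1) => (⟨l, hlt l⟩ : Fin k) := fun l l' h =>
      Fin.ext (congrArg (Fin.val (n := k)) h)
    refine le_approxNumber_of_orthonormal (w := fun l => V (e ⟨l, hlt l⟩))
      ((e.orthonormal.comp_linearIsometry V).comp _ hinj) fun d => ?_
    have h1 : ∑ l, d l • V (e ⟨l, hlt l⟩) = V (∑ l, d l • e ⟨l, hlt l⟩) := by simp
    rw [h1]
    refine le_trans ?_ (pow_le_pow_left₀ (norm_nonneg _) (hMle _) 2)
    rw [map_sum]
    simp only [map_smul]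
    rw [norm_sum_sq_of_pairwise_orthogonal _
      (fun l l' h => hinner _ _ (hinj.ne h)), Finset.mul_sum, coe_nnnorm, hnorm]
    refine Finset.sum_le_sum fun l _ => ?_
    rw [hnorm, mul_comm]
    gcongr
    exact hanti (Fin.mk_le_of_le_val (by omega))
  have htr : ∑ j, ⟪W (c j), a (V (c j))⟫_ℂ = ∑ j, ⟪e j, M (e j)⟫_ℂ := by
    have h1 := LinearMap.trace_eq_sum_inner (M : E →ₗ[ℂ] E) c
    have h2 := LinearMap.trace_eq_sum_inner (M : E →ₗ[ℂ] E) e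
    rw [h1] at h2
    simp only [ContinuousLinearMap.coe_coe] at h2
    rw [← h2]
    simp only [hM]
  rw [htr]
  refine (norm_sum_le _ _).trans (Finset.sum_le_sum fun j _ => ?_)
  refine (norm_inner_le_norm _ _).trans ?_
  rw [e.orthonormal.1 j, one_mul]
  exact hle j

/-- Ky Fan's variational inequality. -/
theorem norm_sum_inner_le_sum_approxNumber (a : H →L[ℂ] H) {k : ℕ} {u v : Fin k → H}
    (hu : Orthonormal ℂ u) (hv : Orthonormal ℂ v) :
    ‖∑ j, ⟪u j, a (v j)⟫_ℂ‖ ≤ ∑ j : Fin k, (approxNumber a j : ℝ) := by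
  let c : OrthonormalBasis (Fin k) ℂ (EuclideanSpace ℂ (Fin k)) := EuclideanSpace.basisFun (Fin k) ℂ
  obtain ⟨V, hV⟩ := exists_linearIsometry_apply_eq c hv
  obtain ⟨W, hW⟩ := exists_linearIsometry_apply_eq c hu
  have h := norm_sum_inner_linearIsometry_le a c V W
  simpa only [hV, hW] using h

/-- Ky Fan's inequality: the sum of the approximation numbers up to any index is subadditive. -/
theorem sum_approxNumber_add_le {a b : H →L[ℂ] H} (ha : IsCompactOperator a)
    (hb : IsCompactOperator b) (k : ℕ) :
    ∑ j ∈ Finset.range k, approxNumber (a + b) j ≤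
      ∑ j ∈ Finset.range k, (approxNumber a j + approxNumber b j) := by
  induction k with
  | zero => simp
  | succ k ih =>
    -- Singular vectors exist only for a non-zero last term; a vanishing one adds nothing and leaves
    -- the induction hypothesis.
    rcases eq_or_ne (approxNumber (a + b) k) 0 with h0 | h0
    · rw [Finset.sum_range_succ, Finset.sum_range_succ, h0, add_zero]
      exact ih.trans le_self_add
    · obtain ⟨v, u, hv, hu, h⟩ := exists_singular_vectors (a := a + b) (ha.add hb)
        (pos_iff_ne_zero.mpr h0)
      have h1 : ∀ j, ⟪u j, (a + b) (v j)⟫_ℂ = ((approxNumber (a + b) j : ℝ) : ℂ) := fun j => by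
        rw [h, inner_smul_right, inner_self_eq_norm_sq_to_K, hu.1 j]
        simp
      have h2 : ‖∑ j, ⟪u j, (a + b) (v j)⟫_ℂ‖
          = ∑ j : Fin (k + 1), (approxNumber (a + b) j : ℝ) := by
        simp only [h1]
        rw [← Complex.ofReal_sum, Complex.norm_real, Real.norm_eq_abs, abs_of_nonneg]
        exact Finset.sum_nonneg fun _ _ => NNReal.coe_nonneg _
      have h3 : ∑ j, ⟪u j, (a + b) (v j)⟫_ℂ
          = ∑ j, ⟪u j, a (v j)⟫_ℂ + ∑ j, ⟪u j, b (v j)⟫_ℂ := by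
        rw [← Finset.sum_add_distrib]
        exact Finset.sum_congr rfl fun j _ => by rw [add_apply, inner_add_right]
      rw [Finset.sum_range, Finset.sum_range, ← NNReal.coe_le_coe, NNReal.coe_sum, ← h2, h3,
        NNReal.coe_sum]
      simp only [NNReal.coe_add]
      rw [Finset.sum_add_distrib]
      exact (norm_add_le _ _).trans (add_le_add (norm_sum_inner_le_sum_approxNumber a hu hv)
        (norm_sum_inner_le_sum_approxNumber b hu hv))

end KyFan

/-! ### Weighted `ℓ^p` inequalities for sequences. -/

section Sequences

/-- Abel summation: a decreasing weight preserves the domination of partial sums. -/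
theorem sum_range_mul_le_of_sum_range_le {c x y : ℕ → ℝ≥0} (hc : Antitone c)
    (h : ∀ k, ∑ j ∈ Finset.range k, x j ≤ ∑ j ∈ Finset.range k, y j) (n : ℕ) :
    ∑ j ∈ Finset.range n, c j * x j ≤ ∑ j ∈ Finset.range n, c j * y j := by
  have h' : ∀ k, 0 ≤ ∑ j ∈ Finset.range k, ((y j : ℝ) - x j) := fun k => by
    rw [Finset.sum_sub_distrib, sub_nonneg]
    exact_mod_cast h k
  -- The partial sums of `y - x` are non-negative, so lowering the factor `c n` to `c (n + 1)` keeps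
  -- the bound.
  have key : ∀ n, (c n : ℝ) * ∑ j ∈ Finset.range (n + 1), ((y j : ℝ) - x j) ≤
      ∑ j ∈ Finset.range (n + 1), (c j : ℝ) * ((y j : ℝ) - x j) := by
    intro n
    induction n with
    | zero => simp
    | succ n ih =>
      rw [Finset.sum_range_succ, Finset.sum_range_succ (fun j => (c j : ℝ) * ((y j : ℝ) - x j)),
        mul_add]
      have hcn : (c (n + 1) : ℝ) ≤ c n := hc (Nat.le_succ n)
      have := mul_le_mul_of_nonneg_right hcn (h' (n + 1))
      linarith
  rcases n with _ | n
  · simp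
  · have h1 := (mul_nonneg (NNReal.coe_nonneg (c n)) (h' (n + 1))).trans (key n)
    simp only [mul_sub, Finset.sum_sub_distrib, sub_nonneg] at h1
    exact_mod_cast h1

theorem rpow_sub_one_mul_self (x : ℝ≥0) {p : ℝ} (hp : 1 ≤ p) : x ^ (p - 1) * x = x ^ p := by
  conv_lhs => rw [← NNReal.rpow_one x, ← NNReal.rpow_mul, one_mul]
  rw [← NNReal.rpow_add_of_nonneg x (sub_nonneg.mpr hp) zero_le_one, sub_add_cancel]

/-- Hölder's inequality after splitting `w = w ^ (1 / q) * w ^ (1 / p)`, with `(p - 1) * q = p`. -/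
theorem weighted_inner_le (w x y : ℕ → ℝ≥0) {p q : ℝ} (hpq : p.HolderConjugate q) (n : ℕ) :
    ∑ j ∈ Finset.range n, w j * x j ^ (p - 1) * y j ≤
      (∑ j ∈ Finset.range n, w j * x j ^ p) ^ (1 / q) *
        (∑ j ∈ Finset.range n, w j * y j ^ p) ^ (1 / p) := by
  have h := NNReal.inner_le_Lp_mul_Lq (Finset.range n)
    (fun j => w j ^ (1 / q) * x j ^ (p - 1)) (fun j => w j ^ (1 / p) * y j) hpq.symm
  have e1 : ∀ j, (w j ^ (1 / q) * x j ^ (p - 1)) ^ q = w j * x j ^ p := fun j => by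
    rw [NNReal.mul_rpow, ← NNReal.rpow_mul, ← NNReal.rpow_mul, one_div,
      inv_mul_cancel₀ hpq.symm.ne_zero, NNReal.rpow_one, hpq.sub_one_mul_conj]
  have e2 : ∀ j, (w j ^ (1 / p) * y j) ^ p = w j * y j ^ p := fun j => by
    rw [NNReal.mul_rpow, ← NNReal.rpow_mul, one_div, inv_mul_cancel₀ hpq.ne_zero,
      NNReal.rpow_one]
  have e3 : ∀ j, w j ^ (1 / q) * x j ^ (p - 1) * (w j ^ (1 / p) * y j)
      = w j * x j ^ (p - 1) * y j := fun j => by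
    have : w j ^ (1 / q) * w j ^ (1 / p) = w j := by
      rw [← NNReal.rpow_add_of_nonneg _ (one_div_nonneg.mpr hpq.symm.nonneg)
        (one_div_nonneg.mpr hpq.nonneg), one_div, one_div, hpq.symm.inv_add_inv_eq_one,
        NNReal.rpow_one]
    calc _ = (w j ^ (1 / q) * w j ^ (1 / p)) * x j ^ (p - 1) * y j := by ring
      _ = _ := by rw [this]
  simpa only [e1, e2, e3] using h

/-- Minkowski's argument, with only partial sums dominated: `w * x ^ (p - 1)` is itself decreasing,
so Abel summation applies with it as weight. Hölder follows, and a factor `X ^ (1 / q)` cancels. -/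
theorem weighted_Lp_le_add {w x y z : ℕ → ℝ≥0} (hw : Antitone w) (hx : Antitone x)
    (h : ∀ k, ∑ j ∈ Finset.range k, x j ≤ ∑ j ∈ Finset.range k, (y j + z j)) {p : ℝ} (hp : 1 ≤ p)
    (n : ℕ) : (∑ j ∈ Finset.range n, w j * x j ^ p) ^ (1 / p) ≤
      (∑ j ∈ Finset.range n, w j * y j ^ p) ^ (1 / p) +
        (∑ j ∈ Finset.range n, w j * z j ^ p) ^ (1 / p) := by
  rcases hp.eq_or_lt with rfl | hp1
  · simp only [NNReal.rpow_one, div_one]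
    rw [← Finset.sum_add_distrib]
    simpa only [mul_add] using sum_range_mul_le_of_sum_range_le hw h n
  have hpq := Real.HolderConjugate.conjExponent hp1
  set q := p.conjExponent
  set X := ∑ j ∈ Finset.range n, w j * x j ^ p with hX
  rcases eq_or_ne X 0 with h0 | h0
  · rw [h0, NNReal.zero_rpow (one_div_ne_zero hpq.ne_zero)]
    exact zero_le
  have hc : Antitone fun j => w j * x j ^ (p - 1) := fun i j hij =>
    mul_le_mul' (hw hij) (NNReal.rpow_le_rpow (hx hij) (sub_nonneg.mpr hp))
  have h1 := sum_range_mul_le_of_sum_range_le hc h n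
  simp only [mul_assoc, rpow_sub_one_mul_self _ hp] at h1
  simp only [← mul_assoc, mul_add, Finset.sum_add_distrib] at h1
  have h2 := h1.trans (add_le_add (weighted_inner_le w x y hpq n) (weighted_inner_le w x z hpq n))
  rw [← hX, ← mul_add] at h2
  have h3 : X ^ (1 / q) * X ^ (1 / p) = X := by
    rw [← NNReal.rpow_add h0, one_div, one_div, hpq.symm.inv_add_inv_eq_one, NNReal.rpow_one]
  refine le_of_mul_le_mul_left (h3.le.trans h2) ?_
  exact NNReal.rpow_pos (pos_iff_ne_zero.mpr h0)

/-- Summation by parts for a decreasing null sequence. -/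
theorem tsum_sub_mul_sum_range {l : ℕ → ℝ≥0} (hl : Antitone l)
    (hl0 : Filter.Tendsto l Filter.atTop (nhds 0)) (d : ℕ → ℝ≥0∞) :
    ∑' i, ((l i - l (i + 1) : ℝ≥0) : ℝ≥0∞) * ∑ j ∈ Finset.range (i + 1), d j =
      ∑' j, d j * l j := by
  have hpart : ∀ j n, ∑ i ∈ Finset.range n, (if j ≤ i then l i - l (i + 1) else 0)
      = l j - l n := by
    intro j n
    induction n with
    | zero => simp [tsub_eq_zero_of_le (hl (Nat.zero_le j))]
    | succ n ih =>
      rw [Finset.sum_range_succ, ih]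
      split_ifs with h
      · exact tsub_add_tsub_cancel (hl h) (hl (Nat.le_succ n))
      · rw [tsub_eq_zero_of_le (hl (by omega)), tsub_eq_zero_of_le (hl (by omega)), add_zero]
  have htail : ∀ j, ∑' i, (if j ≤ i then ((l i - l (i + 1) : ℝ≥0) : ℝ≥0∞) else 0) = l j := by
    intro j
    refine tendsto_nhds_unique (ENNReal.tendsto_nat_tsum _) ?_
    have h1 : ∀ n, ∑ i ∈ Finset.range n, (if j ≤ i then ((l i - l (i + 1) : ℝ≥0) : ℝ≥0∞) else 0)
        = ((l j - l n : ℝ≥0) : ℝ≥0∞) := fun n => by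
      rw [← hpart, ENNReal.ofNNReal_finsetSum]
      exact Finset.sum_congr rfl fun i _ => by split_ifs <;> rfl
    simp only [h1]
    rw [ENNReal.tendsto_coe]
    have h2 : Filter.Tendsto (fun n => l j - l n) Filter.atTop (nhds (l j - 0)) :=
      tendsto_const_nhds.sub hl0
    simpa using h2
  have hsum : ∀ i, ∑ j ∈ Finset.range (i + 1), d j = ∑' j, if j ≤ i then d j else 0 := by
    intro i
    rw [tsum_eq_sum (s := Finset.range (i + 1))]
    · exact Finset.sum_congr rfl fun j hj => by
        rw [if_pos (Nat.lt_succ_iff.mp (Finset.mem_range.mp hj))]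
    · intro j hj
      rw [if_neg fun h => hj (Finset.mem_range.mpr (Nat.lt_succ_iff.mpr h))]
  simp only [hsum, ← ENNReal.tsum_mul_left]
  rw [ENNReal.tsum_comm]
  refine tsum_congr fun j => ?_
  rw [← htail j, ← ENNReal.tsum_mul_left]
  refine tsum_congr fun i => ?_
  split_ifs <;> simp [mul_comm]

/-- The weighted `ℓ^p` norm of a sequence, with values in `[0, ∞]`. -/
def weightedNorm (w : ℕ → ℝ≥0) (p : ℝ) (x : ℕ → ℝ≥0) : ℝ≥0∞ :=
  (∑' j, ((w j * x j ^ p : ℝ≥0) : ℝ≥0∞)) ^ (1 / p)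

/-- Reduces estimates in `[0, ∞]` to finite sums, for which the triangle inequality and continuity
are available. -/
theorem weightedNorm_le_iff (w x : ℕ → ℝ≥0) {p : ℝ} (hp : 0 < p) (C : ℝ≥0∞) :
    weightedNorm w p x ≤ C ↔
      ∀ n, (((∑ j ∈ Finset.range n, w j * x j ^ p) ^ (1 / p) : ℝ≥0) : ℝ≥0∞) ≤ C := by
  have h1 : ∀ n, ((((∑ j ∈ Finset.range n, w j * x j ^ p) ^ (1 / p) : ℝ≥0) : ℝ≥0∞) ≤ C ↔
      ∑ j ∈ Finset.range n, ((w j * x j ^ p : ℝ≥0) : ℝ≥0∞) ≤ C ^ p) := fun n => by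
    rw [ENNReal.coe_rpow_of_nonneg _ (one_div_nonneg.mpr hp.le), one_div,
      ENNReal.rpow_inv_le_iff hp, ENNReal.ofNNReal_finsetSum]
  simp only [h1]
  rw [weightedNorm, one_div, ENNReal.rpow_inv_le_iff hp]
  exact ⟨fun h n => (ENNReal.sum_le_tsum _).trans h, ENNReal.tsum_le_of_sum_range_le⟩

theorem le_weightedNorm (w x : ℕ → ℝ≥0) {p : ℝ} (hp : 0 < p) (n : ℕ) :
    (((∑ j ∈ Finset.range n, w j * x j ^ p) ^ (1 / p) : ℝ≥0) : ℝ≥0∞) ≤ weightedNorm w p x :=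
  (weightedNorm_le_iff w x hp _).mp le_rfl n

theorem weightedNorm_mono (w : ℕ → ℝ≥0) {p : ℝ} (hp : 0 < p) {x y : ℕ → ℝ≥0}
    (h : ∀ j, x j ≤ y j) : weightedNorm w p x ≤ weightedNorm w p y := by
  unfold weightedNorm
  gcongr with j
  exact h j

theorem weightedNorm_const_mul (w : ℕ → ℝ≥0) {p : ℝ} (hp : 0 < p) (c : ℝ≥0) (x : ℕ → ℝ≥0) :
    weightedNorm w p (fun j => c * x j) = c * weightedNorm w p x := by
  have h : ∀ j, ((w j * (c * x j) ^ p : ℝ≥0) : ℝ≥0∞)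
      = ((c ^ p : ℝ≥0) : ℝ≥0∞) * ((w j * x j ^ p : ℝ≥0) : ℝ≥0∞) := fun j => by
    rw [NNReal.mul_rpow, mul_left_comm, ENNReal.coe_mul]
  rw [weightedNorm, weightedNorm, tsum_congr h, ENNReal.tsum_mul_left,
    ENNReal.mul_rpow_of_nonneg _ _ (one_div_nonneg.mpr hp.le), ENNReal.coe_rpow_of_nonneg _ hp.le,
    ← ENNReal.rpow_mul, mul_one_div_cancel hp.ne', ENNReal.rpow_one]

theorem weightedNorm_le_add {w x y z : ℕ → ℝ≥0} (hw : Antitone w) (hx : Antitone x)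
    (h : ∀ k, ∑ j ∈ Finset.range k, x j ≤ ∑ j ∈ Finset.range k, (y j + z j)) {p : ℝ}
    (hp : 1 ≤ p) : weightedNorm w p x ≤ weightedNorm w p y + weightedNorm w p z := by
  have hp0 := zero_lt_one.trans_le hp
  refine (weightedNorm_le_iff w x hp0 _).mpr fun n => ?_
  refine (ENNReal.coe_le_coe.mpr (weighted_Lp_le_add hw hx h hp n)).trans ?_
  rw [ENNReal.coe_add]
  exact add_le_add (le_weightedNorm w y hp0 n) (le_weightedNorm w z hp0 n)

/-- The weighted `ℓ^p` norm is lower semicontinuous for pointwise convergence. -/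
theorem weightedNorm_le_of_tendsto (w : ℕ → ℝ≥0) {p : ℝ} (hp : 0 < p) {x : ℕ → ℕ → ℝ≥0}
    {y : ℕ → ℝ≥0} (hxy : ∀ j, Filter.Tendsto (fun m => x m j) Filter.atTop (nhds (y j)))
    {C : ℝ≥0∞} (h : ∀ᶠ m in Filter.atTop, weightedNorm w p (x m) ≤ C) :
    weightedNorm w p y ≤ C := by
  refine (weightedNorm_le_iff w y hp _).mpr fun n => ?_
  have hlim : Filter.Tendsto
      (fun m => (((∑ j ∈ Finset.range n, w j * x m j ^ p) ^ (1 / p) : ℝ≥0) : ℝ≥0∞)) Filter.atTop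
      (nhds (((∑ j ∈ Finset.range n, w j * y j ^ p) ^ (1 / p) : ℝ≥0) : ℝ≥0∞)) := by
    rw [ENNReal.tendsto_coe]
    refine ((NNReal.continuous_rpow_const (one_div_nonneg.mpr hp.le)).tendsto _).comp ?_
    exact tendsto_finsetSum _ fun j _ =>
      (((NNReal.continuous_rpow_const hp.le).tendsto _).comp (hxy j)).const_mul (w j)
  exact le_of_tendsto hlim (h.mono fun m hm => (weightedNorm_le_iff w (x m) hp C).mp hm n)

end Sequences

/-! ### The weighted Schatten norm and its completeness. -/

section SchattenNorm

variable {H : Type*} [NormedAddCommGroup H] [InnerProductSpace ℂ H] [CompleteSpace H]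

/-- The increments of a weight sequence. -/
def increment (α : ℕ → ℝ≥0) (j : ℕ) : ℝ≥0 := α (j + 1) - α j

theorem increment_antitone {α : ℕ → ℝ≥0} (hmono : Monotone α)
    (hconc : ∀ i : ℕ, 1 ≤ i → (α (i + 1) + α (i - 1)) / 2 ≤ α i) : Antitone (increment α) := by
  refine antitone_nat_of_succ_le fun i => ?_
  have h := hconc (i + 1) (Nat.le_add_left 1 i)
  rw [Nat.add_sub_cancel, div_le_iff₀ two_pos] at h
  have h1 : (α i : ℝ) ≤ α (i + 1) := hmono (Nat.le_succ i)
  have h2 : (α (i + 1) : ℝ) ≤ α (i + 1 + 1) := hmono (Nat.le_succ _)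
  have h3 : (α (i + 1 + 1) : ℝ) + α i ≤ α (i + 1) * 2 := by exact_mod_cast h
  rw [← NNReal.coe_le_coe, increment, increment, NNReal.coe_sub (hmono (Nat.le_succ _)),
    NNReal.coe_sub (hmono (Nat.le_succ _))]
  linarith

/-- On compact operators, `schattenNorm` is the weighted `ℓ^p` norm of the approximation
numbers. -/
theorem schattenNorm_eq_weightedNorm {α : ℕ → ℝ≥0} (hmono : Monotone α) (h0 : α 0 = 0) {p : ℝ}
    (hp : 0 < p) {a : H →L[ℂ] H} (ha : IsCompactOperator a) :
    schattenNorm α p a = weightedNorm (increment α) p (approxNumber a) := by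
  rw [schattenNorm, weightedNorm, choquetTrace]
  congr 1
  have hanti : Antitone fun i => approxNumber a i ^ p := fun i j hij =>
    NNReal.rpow_le_rpow (approxNumber_antitone a hij) hp.le
  have hlim : Filter.Tendsto (fun i => approxNumber a i ^ p) Filter.atTop (nhds 0) := by
    have := ((NNReal.continuous_rpow_const hp.le).tendsto 0).comp (tendsto_approxNumber ha)
    rwa [NNReal.zero_rpow hp.ne'] at this
  have h := tsum_sub_mul_sum_range hanti hlim fun j => (increment α j : ℝ≥0∞)
  simp only [ENNReal.coe_mul]
  rw [← h]
  refine tsum_congr fun i => ?_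
  congr 1
  · rw [eigenvalueSeq_abs_rpow ha hp, eigenvalueSeq_abs_rpow ha hp, ← NNReal.coe_rpow,
      ← NNReal.coe_rpow, ← NNReal.coe_sub (hanti (Nat.le_succ i)), ENNReal.ofReal_coe_nnreal]
  · rw [← ENNReal.ofNNReal_finsetSum, ENNReal.coe_inj]
    -- The increments telescope to `α (i + 1) - α 0`, and `α 0 = 0`.
    have := Finset.sum_range_tsub hmono (i + 1)
    rw [h0, tsub_zero] at this
    exact this.symm

variable {α : ℕ → ℝ≥0} {p : ℝ} {a b : H →L[ℂ] H}

theorem schattenNorm_le_mul (hmono : Monotone α) (h0 : α 0 = 0) (hp : 0 < p)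
    (ha : IsCompactOperator a) (hb : IsCompactOperator b) (c : ℝ≥0)
    (h : ∀ j, approxNumber b j ≤ c * approxNumber a j) :
    schattenNorm α p b ≤ c * schattenNorm α p a := by
  rw [schattenNorm_eq_weightedNorm hmono h0 hp ha, schattenNorm_eq_weightedNorm hmono h0 hp hb,
    ← weightedNorm_const_mul _ hp]
  exact weightedNorm_mono _ hp h

theorem schattenNorm_smul (hmono : Monotone α) (h0 : α 0 = 0) (hp : 0 < p)
    (ha : IsCompactOperator a) (c : ℂ) :
    schattenNorm α p (c • a) = ‖c‖₊ * schattenNorm α p a := by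
  have hca : IsCompactOperator (c • a : H →L[ℂ] H) := ha.smul c
  rw [schattenNorm_eq_weightedNorm hmono h0 hp ha, schattenNorm_eq_weightedNorm hmono h0 hp hca,
    ← weightedNorm_const_mul _ hp]
  congr 1
  funext j
  exact approxNumber_smul c a j

theorem schattenNorm_zero (hp : 0 < p) (hmono : Monotone α) (h0 : α 0 = 0) :
    schattenNorm α p (0 : H →L[ℂ] H) = 0 := by
  have h := schattenNorm_smul (H := H) (a := 0) hmono h0 hp isCompactOperator_zero 0
  simpa using h

theorem schattenNorm_add_le (hmono : Monotone α) (h0 : α 0 = 0)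
    (hconc : ∀ i : ℕ, 1 ≤ i → (α (i + 1) + α (i - 1)) / 2 ≤ α i) (hp : 1 ≤ p)
    (ha : IsCompactOperator a) (hb : IsCompactOperator b) :
    schattenNorm α p (a + b) ≤ schattenNorm α p a + schattenNorm α p b := by
  have hp0 := zero_lt_one.trans_le hp
  have hab : IsCompactOperator (a + b : H →L[ℂ] H) := ha.add hb
  rw [schattenNorm_eq_weightedNorm hmono h0 hp0 ha, schattenNorm_eq_weightedNorm hmono h0 hp0 hb,
    schattenNorm_eq_weightedNorm hmono h0 hp0 hab]
  exact weightedNorm_le_add (increment_antitone hmono hconc) (approxNumber_antitone _)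
    (sum_approxNumber_add_le ha hb) hp

/-- This is the single term `j = 0` of the series: its weight is `α 1` and its approximation number
is the operator norm. -/
theorem nnnorm_le_schattenNorm (hmono : Monotone α) (h0 : α 0 = 0) (hp : 0 < p)
    (ha : IsCompactOperator a) :
    ((α 1 ^ (1 / p) * ‖a‖₊ : ℝ≥0) : ℝ≥0∞) ≤ schattenNorm α p a := by
  rw [schattenNorm_eq_weightedNorm hmono h0 hp ha]
  have h := le_weightedNorm (increment α) (approxNumber a) hp 1
  rwa [Finset.sum_range_one, approxNumber_zero_right, increment, h0, tsub_zero, zero_add,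
    NNReal.mul_rpow, ← NNReal.rpow_mul, mul_one_div_cancel hp.ne', NNReal.rpow_one] at h

theorem schattenNorm_le_of_tendsto (hmono : Monotone α) (h0 : α 0 = 0) (hp : 0 < p)
    {x : ℕ → H →L[ℂ] H} (hx : ∀ m, IsCompactOperator (x m)) (ha : IsCompactOperator a)
    (hxa : Filter.Tendsto x Filter.atTop (nhds a)) {C : ℝ≥0∞}
    (h : ∀ᶠ m in Filter.atTop, schattenNorm α p (x m) ≤ C) : schattenNorm α p a ≤ C := by
  rw [schattenNorm_eq_weightedNorm hmono h0 hp ha]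
  refine weightedNorm_le_of_tendsto _ hp (x := fun m => approxNumber (x m))
    (fun j => ((continuous_approxNumber j).tendsto a).comp hxa) (h.mono fun m hm => ?_)
  rwa [schattenNorm_eq_weightedNorm hmono h0 hp (hx m)] at hm

/-- Adjoints of finite-rank approximants of `a` have finite rank and converge to `star a`, and
compact operators form a closed set. -/
theorem isCompactOperator_star (ha : IsCompactOperator a) :
    IsCompactOperator (star a : H →L[ℂ] H) := by
  have hcl := isClosed_setOfPred_isCompactOperator (σ₁₂ := RingHom.id ℂ) (M₁ := H) (M₂ := H)
  refine hcl.closure_subset (Metric.mem_closure_iff.mpr fun ε hε => ?_)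
  lift ε to ℝ≥0 using hε.le
  obtain ⟨n, hn⟩ := ((tendsto_approxNumber ha).eventually_lt_const
    (NNReal.coe_pos.mp hε)).exists
  obtain ⟨f, hf, hfε⟩ := exists_of_approxNumber_lt hn
  have hfin := finiteDimensional_range_of_rank_le hf
  refine ⟨star f, ?_, ?_⟩
  · rw [star_eq_star_mul_starProjection_range f]
    set F := LinearMap.range (f : H →ₗ[ℂ] H)
    exact (isCompactOperator_id (E := F)).clm_comp (star f ∘L F.subtypeL) |>.comp_clm
      F.orthogonalProjectionOnto
  · rw [dist_eq_norm, ← star_sub, norm_star]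
    exact hfε

variable (H) in
/-- The weighted Schatten class as a subspace of the bounded operators. -/
def schattenSubmodule (hmono : Monotone α) (h0 : α 0 = 0)
    (hconc : ∀ i : ℕ, 1 ≤ i → (α (i + 1) + α (i - 1)) / 2 ≤ α i) (hp : 1 ≤ p) :
    Submodule ℂ (H →L[ℂ] H) where
  carrier := schattenClass H α p
  add_mem' ha hb := ⟨ha.1.add hb.1,
    (schattenNorm_add_le hmono h0 hconc hp ha.1 hb.1).trans_lt (ENNReal.add_lt_top.mpr ⟨ha.2, hb.2⟩)⟩
  zero_mem' := ⟨isCompactOperator_zero, by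
    rw [schattenNorm_zero (zero_lt_one.trans_le hp) hmono h0]; exact ENNReal.zero_lt_top⟩
  smul_mem' c a ha := ⟨ha.1.smul c, by
    rw [schattenNorm_smul hmono h0 (zero_lt_one.trans_le hp) ha.1]
    exact ENNReal.mul_lt_top ENNReal.coe_lt_top ha.2⟩

/-- A norm for which every Cauchy sequence converges is a Banach space norm. -/
theorem isBanachWith_of_cauchy {E : Type*} [AddCommGroup E] [Module ℂ E] {N : E → ℝ}
    (hnonneg : ∀ x, 0 ≤ N x) (hsmul : ∀ (c : ℂ) x, N (c • x) = ‖c‖ * N x)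
    (htri : ∀ x y, N (x + y) ≤ N x + N y) (hzero : ∀ x, N x = 0 → x = 0)
    (hcomplete : ∀ u : ℕ → E,
      (∀ ε > 0, ∃ M, ∀ m ≥ M, ∀ n ≥ M, N (u m - u n) < ε) →
        ∃ x, ∀ ε > 0, ∃ M, ∀ n ≥ M, N (u n - x) < ε) : IsBanachWith N := by
  let _ : Norm E := ⟨N⟩
  have core : NormedSpace.Core ℂ E :=
    { norm_nonneg := hnonneg
      norm_smul := hsmul
      norm_triangle := htri
      norm_eq_zero_iff := fun x => ⟨hzero x, fun h => by
        have h0 := hsmul 0 0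
        rw [norm_zero, zero_mul, zero_smul] at h0
        rw [h]
        exact h0⟩ }
  refine ⟨core, ?_⟩
  let _ : NormedAddCommGroup E := NormedAddCommGroup.ofCore core
  have hdist : ∀ x y : E, dist x y = N (x - y) := dist_eq_norm
  refine Metric.complete_of_cauchySeq_tendsto fun u hu => ?_
  obtain ⟨x, hx⟩ := hcomplete u (by simpa only [Metric.cauchySeq_iff, hdist] using hu)
  exact ⟨x, Metric.tendsto_atTop.mpr (by simpa only [hdist] using hx)⟩

theorem isBanachWith_schattenNorm (hmono : Monotone α) (h0 : α 0 = 0) (h1 : 0 < α 1)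
    (hconc : ∀ i : ℕ, 1 ≤ i → (α (i + 1) + α (i - 1)) / 2 ≤ α i) (hp : 1 ≤ p) :
    IsBanachWith (fun a : schattenSubmodule H hmono h0 hconc hp =>
      (schattenNorm α p (a : H →L[ℂ] H)).toReal) := by
  set V := schattenSubmodule H hmono h0 hconc hp
  have hp0 := zero_lt_one.trans_le hp
  have hK : (0 : ℝ) < (α 1 ^ (1 / p) : ℝ≥0) := NNReal.coe_pos.mpr (NNReal.rpow_pos h1)
  -- Finiteness on `V` is essential here, since `toReal` sends `∞` to `0`.
  have hlow : ∀ a : V, (α 1 ^ (1 / p) : ℝ≥0) * ‖(a : H →L[ℂ] H)‖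
      ≤ (schattenNorm α p (a : H →L[ℂ] H)).toReal := fun a =>
    ENNReal.toReal_mono a.2.2.ne (nnnorm_le_schattenNorm hmono h0 hp0 a.2.1)
  refine isBanachWith_of_cauchy (fun _ => ENNReal.toReal_nonneg) (fun c a => ?_) (fun a b => ?_)
    (fun a h => ?_) fun u hu => ?_
  · rw [Submodule.coe_smul, schattenNorm_smul hmono h0 hp0 a.2.1, ENNReal.toReal_mul,
      ENNReal.coe_toReal, coe_nnnorm]
  · rw [← ENNReal.toReal_add a.2.2.ne b.2.2.ne]
    exact ENNReal.toReal_mono (ENNReal.add_lt_top.mpr ⟨a.2.2, b.2.2⟩).ne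
      (schattenNorm_add_le hmono h0 hconc hp a.2.1 b.2.1)
  · have h2 := hlow a
    rw [h] at h2
    exact Subtype.ext (norm_le_zero_iff.mp (le_of_mul_le_mul_left (by simpa using h2) hK))
  have hu' : CauchySeq fun m => (u m : H →L[ℂ] H) := by
    rw [Metric.cauchySeq_iff]
    intro ε hε
    obtain ⟨N, hN⟩ := hu ((α 1 ^ (1 / p) : ℝ≥0) * ε) (mul_pos hK hε)
    refine ⟨N, fun m hm n hn => ?_⟩
    rw [dist_eq_norm]
    exact lt_of_mul_lt_mul_left ((hlow (u m - u n)).trans_lt (hN m hm n hn)) hK.le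
  obtain ⟨a, ha⟩ := cauchySeq_tendsto_of_complete hu'
  have hac : IsCompactOperator a :=
    isCompactOperator_of_tendsto ha (Filter.Eventually.of_forall fun m => (u m).2.1)
  have hclose : ∀ ε : ℝ, 0 < ε → ∃ N, ∀ n ≥ N,
      schattenNorm α p ((u n : H →L[ℂ] H) - a) ≤ ENNReal.ofReal ε := by
    intro ε hε
    obtain ⟨N, hN⟩ := hu ε hε
    refine ⟨N, fun n hn => ?_⟩
    -- Fix `n` and let `m → ∞` in the Cauchy estimate for `u n - u m`.
    refine schattenNorm_le_of_tendsto hmono h0 hp0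
      (x := fun m => (u n : H →L[ℂ] H) - (u m : H →L[ℂ] H)) (fun m => (u n - u m).2.1) ((u n).2.1.sub hac)
      (tendsto_const_nhds.sub ha) ?_
    filter_upwards [Filter.eventually_ge_atTop N] with m hm
    exact (ENNReal.le_ofReal_iff_toReal_le (u n - u m).2.2.ne hε.le).mpr (hN n hn m hm).le
  have haV : a ∈ V := by
    obtain ⟨N, hN⟩ := hclose 1 one_pos
    have h2 : (u N : H →L[ℂ] H) - a ∈ V :=
      ⟨(u N).2.1.sub hac, (hN N le_rfl).trans_lt ENNReal.ofReal_lt_top⟩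
    simpa using V.sub_mem (u N).2 h2
  refine ⟨⟨a, haV⟩, fun ε hε => ?_⟩
  obtain ⟨N, hN⟩ := hclose (ε / 2) (half_pos hε)
  exact ⟨N, fun n hn =>
    (ENNReal.toReal_le_of_le_ofReal (half_pos hε).le (hN n hn)).trans_lt (half_lt_self hε)⟩

end SchattenNorm

end Choquet
end

/-! ### The Banach `*`-ideal. -/

theorem mainTheorem4 {H : Type*} [NormedAddCommGroup H] [InnerProductSpace ℂ H] [CompleteSpace H]
    [TopologicalSpace.SeparableSpace H] (hH : ¬ FiniteDimensional ℂ H)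
    (p : ℝ) (hp : 1 ≤ p)
    (α : ℕ → ℝ≥0) (hmono : Monotone α) (h0 : α 0 = 0) (h1 : 0 < α 1)
    (hconc : ∀ i : ℕ, 1 ≤ i → (α (i + 1) + α (i - 1)) / 2 ≤ α i) :
    ∃ V : Submodule ℂ (H →L[ℂ] H),
      (V : Set (H →L[ℂ] H)) = Choquet.schattenClass H α p ∧
      Choquet.IsBanachWith (fun a : V => (Choquet.schattenNorm α p (a : H →L[ℂ] H)).toReal) ∧
      (∀ a ∈ V, star a ∈ V) ∧
      (∀ a ∈ V, ∀ b : H →L[ℂ] H, a * b ∈ V ∧ b * a ∈ V) := by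
  have hp0 := zero_lt_one.trans_le hp
  refine ⟨Choquet.schattenSubmodule H hmono h0 hconc hp, rfl,
    Choquet.isBanachWith_schattenNorm hmono h0 h1 hconc hp, fun a ha => ?_, fun a ha b => ?_⟩
  · have hs := Choquet.isCompactOperator_star ha.1
    refine ⟨hs, (Choquet.schattenNorm_le_mul hmono h0 hp0 ha.1 hs 1 fun j => ?_).trans_lt
      (ENNReal.mul_lt_top ENNReal.coe_lt_top ha.2)⟩
    rw [one_mul, Choquet.approxNumber_star]
  · have hab : IsCompactOperator (a * b : H →L[ℂ] H) := ha.1.comp_clm b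
    have hba : IsCompactOperator (b * a : H →L[ℂ] H) := ha.1.clm_comp b
    refine ⟨⟨hab, (Choquet.schattenNorm_le_mul hmono h0 hp0 ha.1 hab ‖b‖₊ fun j => ?_).trans_lt
        (ENNReal.mul_lt_top ENNReal.coe_lt_top ha.2)⟩,
      ⟨hba, (Choquet.schattenNorm_le_mul hmono h0 hp0 ha.1 hba ‖b‖₊ fun j => ?_).trans_lt
        (ENNReal.mul_lt_top ENNReal.coe_lt_top ha.2)⟩⟩
    · rw [mul_comm]
      exact Choquet.approxNumber_mul_le_right a b j
    · exact Choquet.approxNumber_mul_le_left a b j
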